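/- Let $S=(\xi_1,\dots,\xi_n)$, $n\ge 1$, be a data set and let $f(\cdot,\xi_i):\mathbb{R}^d\to\mathbb{R}$ be, for every $i$, $L$-Lipschitz and $\beta$-smooth ($L,\beta>0$), i.e. differentiable with $|f(u,\xi_i)-f(v,\xi_i)-\langle\nabla f(v,\xi_i),u-v\rangle|\le\frac{\beta}{2}\|u-v\|^2$ for all $u,v$. Let $F(w,S)=\frac1n\sum_{i=1}^n f(w,\xi_i)$ be bounded below, $F^*=\inf_w F(w,S)$, let $w_0\in\mathbb{R}^d$, and put $D_F=\sqrt{2(F(w_0,S)-F^*)/\beta}$. Let $\varepsilon\in(0,1]$, $\delta,\gamma\in(0,1)$, $$\sigma^2=4L^2+\frac{4dL^2\log(3n/\delta)\log(2/\delta)}{\varepsilon^2},\qquad \eta_k=\min\Big\{\frac1\beta,\frac{D_F}{\sigma n}\Big\}\quad(0\le k<n^2).$$ Consider Random Round Private SGD: for $0\le t<n^2$ draw, all independently, $\xi^{(t)}$ uniformly from the $n$ entries of $S$ and $z_t\in\mathbb{R}^d$ with density proportional to $\exp\big(-\frac{\varepsilon^2\|z\|^2}{8L^2\log(3n/\delta)\log(2/\delta)}\big)$,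 and let $w_{t+1}=w_t-\eta_t(\nabla f(w_t,\xi^{(t)})+z_t)$. Independently of these draws, draw $R\in\{1,\dots,n^2\}$ with $$\Pr(R=k+1)=\frac{2\eta_k-\beta\eta_k^2}{\sum_{r=0}^{n^2-1}(2\eta_r-\beta\eta_r^2)},\qquad k=0,\dots,n^2-1$$ (any law is allowed in the degenerate case $D_F=0$, where all $\eta_k=0$), and output $w_{priv}=w_R$. Then for all $L,\beta>0$, $D\in\mathbb{R}$ and $\kappa<1$ there is a constant $C>0$, depending only on $L,\beta,D,\kappa$, such that for all $d$, $n$, $S$, $f$, $w_0$, $\varepsilon$, $\delta$, $\gamma$ as above with $D_F\le D$ and $\delta,\gamma\le\kappa$, with probability at least $1-\gamma$ over the draws $(\xi^{(t)},z_t)_{0\le t<n^2}$, $$\mathbb{E}_R\,\|\nabla F(w_{priv},S)\|^2\;\le\; C\,\frac{\sqrt{d\,\log(1/\gamma)\,\log(n/\delta)\,\log(1/\delta)}}{n\varepsilon},$$ where $\mathbb{E}_R$ is the expectation over $R$ alone. -/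

import Mathlib

open MeasureTheory ProbabilityTheory Finset
open scoped ENNReal NNReal

noncomputable section

/-- `g` is `β`-smooth: differentiable, with
`|g u - g v - ⟪∇g v, u - v⟫| ≤ (β / 2) ‖u - v‖²` for all `u`, `v`. -/
def IsBetaSmooth {d : ℕ} (β : ℝ) (g : EuclideanSpace ℝ (Fin d) → ℝ) : Prop :=
  Differentiable ℝ g ∧
    ∀ u v, |g u - g v - inner ℝ (gradient g v) (u - v)| ≤ β / 2 * ‖u - v‖ ^ 2

/-- The empirical risk `F(w, S) = (1/n) ∑ᵢ f(w, ξᵢ)` of the data set `S = (ξ₁, …, ξₙ)`. -/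
def empiricalRisk {d n : ℕ} {X : Type*} (f : EuclideanSpace ℝ (Fin d) → X → ℝ)
    (S : Fin n → X) (w : EuclideanSpace ℝ (Fin d)) : ℝ :=
  (1 / (n : ℝ)) * ∑ i, f w (S i)

/-- `D_F = √(2 (F(w₀, S) - F*) / β)` with `F* = inf_w F(w, S)`. -/
def initialGap {d n : ℕ} {X : Type*} (β : ℝ) (f : EuclideanSpace ℝ (Fin d) → X → ℝ)
    (S : Fin n → X) (w₀ : EuclideanSpace ℝ (Fin d)) : ℝ :=
  Real.sqrt (2 * (empiricalRisk f S w₀ - ⨅ w, empiricalRisk f S w) / β)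

/-- The unnormalised density `exp(-ε² ‖z‖² / (8 L² log(3n/δ) log(2/δ)))` of the noise. -/
def noiseWeight (d n : ℕ) (L ε δ : ℝ) (z : EuclideanSpace ℝ (Fin d)) : ℝ :=
  Real.exp (-(ε ^ 2 * ‖z‖ ^ 2 / (8 * L ^ 2 * Real.log (3 * n / δ) * Real.log (2 / δ))))

/-- The law of one noise vector: density proportional to `noiseWeight`. -/
def noiseLaw (d n : ℕ) (L ε δ : ℝ) : Measure (EuclideanSpace ℝ (Fin d)) :=
  volume.withDensity fun z =>
    ENNReal.ofReal (noiseWeight d n L ε δ z / ∫ y, noiseWeight d n L ε δ y)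

/-- The joint law of all the draws `(ξ_t, z_t)`, `0 ≤ t < n²`: they are mutually independent, the
index of the sampled data point is uniform on the `n` indices and `z_t` has law `noiseLaw`. -/
def drawsLaw (d n : ℕ) (L ε δ : ℝ) :
    Measure (Fin (n ^ 2) → Fin n × EuclideanSpace ℝ (Fin d)) :=
  Measure.pi fun _ => (uniformOn (Set.univ : Set (Fin n))).prod (noiseLaw d n L ε δ)

/-- The iterates `w_0, …, w_T` of noisy stochastic gradient descent along the draws `ω`:
`w_{t+1} = w_t - η_t (∇f(w_t, ξ_t) + z_t)`, where `ω t = (index of ξ_t, z_t)`. -/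
def noisyIterate {d n T : ℕ} {X : Type*} (f : EuclideanSpace ℝ (Fin d) → X → ℝ)
    (S : Fin n → X) (η : Fin T → ℝ) (w₀ : EuclideanSpace ℝ (Fin d))
    (ω : Fin T → Fin n × EuclideanSpace ℝ (Fin d)) : Fin (T + 1) → EuclideanSpace ℝ (Fin d) :=
  Fin.induction (motive := fun _ => EuclideanSpace ℝ (Fin d)) w₀ fun t w =>
    w - η t • (gradient (fun u => f u (S (ω t).1)) w + (ω t).2)

/-- `P` is the law of `R - 1` for the random number of rounds `R ∈ {1, …, T}`:
`Pr(R = k + 1) = (2 η_k - β η_k²) / ∑_r (2 η_r - β η_r²)` for `0 ≤ k < T`. The equation is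
multiplied out, so that in the degenerate case of zero step sizes (where the quotient is
undefined) every law is allowed. -/
def IsRoundLaw {T : ℕ} (β : ℝ) (η : Fin T → ℝ) (P : PMF (Fin T)) : Prop :=
  ∀ k, (P k).toReal * ∑ r, (2 * η r - β * η r ^ 2) = 2 * η k - β * η k ^ 2

/-- The expectation of `‖∇F(w_priv, S)‖²` over the random number of rounds `R` alone, with the
draws `ω` fixed; the output is `w_priv = w_R` and `R = k + 1` has probability `P k`. -/
def expectedSqGrad {d n T : ℕ} {X : Type*} (f : EuclideanSpace ℝ (Fin d) → X → ℝ)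
    (S : Fin n → X) (η : Fin T → ℝ) (w₀ : EuclideanSpace ℝ (Fin d)) (P : PMF (Fin T))
    (ω : Fin T → Fin n × EuclideanSpace ℝ (Fin d)) : ℝ :=
  ∑ k, (P k).toReal * ‖gradient (empiricalRisk f S) (noisyIterate f S η w₀ ω k.succ)‖ ^ 2

/-- `σ = √(4 L² + 4 d L² log(3n/δ) log(2/δ) / ε²)`. -/
def noiseScale (d n : ℕ) (L ε δ : ℝ) : ℝ :=
  Real.sqrt (4 * L ^ 2 +
    4 * d * L ^ 2 * Real.log (3 * n / δ) * Real.log (2 / δ) / ε ^ 2)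

/-- The constant step size `η_k = min {1/β, D_F / (σ n)}`. -/
def tunedStep {d n : ℕ} {X : Type*} (L β ε δ : ℝ) (f : EuclideanSpace ℝ (Fin d) → X → ℝ)
    (S : Fin n → X) (w₀ : EuclideanSpace ℝ (Fin d)) : Fin (n ^ 2) → ℝ :=
  fun _ => min (1 / β) (initialGap β f S w₀ / (noiseScale d n L ε δ * n))

end

/-!
The proof runs a high-probability version of the descent argument for stochastic gradient descent
and uses a single exponential moment.

Write `v = ∇F(w)`, let `N` be the deviation of the noisy stochastic gradient from `v`, and let `h`
be the constant step size, so that `β h ≤ 1`. Smoothness of `F` gives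
`½ ‖v‖² ≤ (F(w) - F(w')) / h + Y + 4 β h L²` for one step `w → w'`, where
`Y = -(1 - β h) ⟪v, N⟫ + β h ‖z‖²` is the `stochasticDrift`
(`half_sq_norm_gradient_le`, summed in `sum_sq_norm_gradient_le`).

The martingale part and the squared noise are controlled together. For fixed `w`, Hoeffding's
lemma for the sampling error (`sampling_lintegral_le`) and the explicit Gaussian integral for the
added noise (`noise_lintegral_le`) bound `E exp(r Y)` by a constant `exp c` that does not depend on
`w`. As the draws are independent, this bound multiplies along the iterates
(`lintegral_prod_noisyIterate_le`), and Markov's inequality gives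
`∑ Y ≤ (n² c + log (1/γ)) / r` with probability at least `1 - γ` (`sum_stochasticDrift_tail`).

Let `ρ` be the standard deviation of a coordinate of the noise and `Λ = √(log (1/γ))`. If `Λ ≤ n`,
the choice `r = Λ / (n K ρ)` makes each term of the averaged inequality `O(√d Λ ρ / n)`
(`averaged_bound_le`). If `Λ ≥ n`, that quantity is at least of constant order and the
Lipschitz bound `‖∇F‖ ≤ L` suffices. Finally
`ρ = O(√(log (n/δ) log (1/δ)) / ε)`, because `δ ≤ κ < 1` (`noiseStd_le`). In the degenerate cases
`d = 0` and `D_F = 0` all gradients along the iterates vanish.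
-/

/-! ### Gradients of the empirical risk -/

section Gradients

variable {d n : ℕ} {X : Type*} {f : EuclideanSpace ℝ (Fin d) → X → ℝ} {S : Fin n → X}

theorem gradient_empiricalRisk (hf : ∀ i, Differentiable ℝ fun w => f w (S i))
    (w : EuclideanSpace ℝ (Fin d)) :
    gradient (empiricalRisk f S) w =
      (1 / (n : ℝ)) • ∑ i, gradient (fun u => f u (S i)) w := by
  apply HasGradientAt.gradient
  rw [hasGradientAt_iff_hasFDerivAt, map_smul, map_sum]
  have h := (HasFDerivAt.fun_sum (u := (univ : Finset (Fin n)))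
    fun i _ => (hf i w).hasGradientAt.hasFDerivAt).const_mul (1 / (n : ℝ))
  exact h

theorem isBetaSmooth_empiricalRisk {β : ℝ} (hn : 1 ≤ n)
    (hf : ∀ i, IsBetaSmooth β fun w => f w (S i)) : IsBetaSmooth β (empiricalRisk f S) := by
  have hn0 : (0 : ℝ) < n := by exact_mod_cast hn
  refine ⟨?_, fun u v => ?_⟩
  · unfold empiricalRisk
    exact (Differentiable.fun_sum fun i _ => (hf i).1).const_mul _
  · have h : empiricalRisk f S u - empiricalRisk f S v
          - inner ℝ (gradient (empiricalRisk f S) v) (u - v)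
        = (1 / (n : ℝ)) * ∑ i, (f u (S i) - f v (S i)
          - inner ℝ (gradient (fun w => f w (S i)) v) (u - v)) := by
      rw [gradient_empiricalRisk (fun i => (hf i).1), real_inner_smul_left, sum_inner,
        empiricalRisk, empiricalRisk, sum_sub_distrib, sum_sub_distrib]
      ring
    rw [h, abs_mul, abs_of_pos (by positivity : 0 < 1 / (n : ℝ))]
    calc _ ≤ 1 / (n : ℝ) * ∑ _i : Fin n, β / 2 * ‖u - v‖ ^ 2 := by
          gcongr
          exact (abs_sum_le_sum_abs _ _).trans (sum_le_sum fun i _ => (hf i).2 u v)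
      _ = β / 2 * ‖u - v‖ ^ 2 := by simp; field_simp

theorem norm_gradient_le_of_lipschitzWith {L : ℝ} (hL : 0 ≤ L)
    {g : EuclideanSpace ℝ (Fin d) → ℝ} (hg : LipschitzWith L.toNNReal g)
    (w : EuclideanSpace ℝ (Fin d)) : ‖gradient g w‖ ≤ L := by
  simpa [gradient, hL] using norm_fderiv_le_of_lipschitz ℝ hg (x₀ := w)

theorem norm_gradient_empiricalRisk_le {L : ℝ} (hL : 0 ≤ L) (hn : 1 ≤ n)
    (hf : ∀ i, Differentiable ℝ fun w => f w (S i))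
    (hLip : ∀ i, LipschitzWith L.toNNReal fun w => f w (S i))
    (w : EuclideanSpace ℝ (Fin d)) : ‖gradient (empiricalRisk f S) w‖ ≤ L := by
  have hn0 : (0 : ℝ) < n := by exact_mod_cast hn
  rw [gradient_empiricalRisk hf, norm_smul, Real.norm_of_nonneg (by positivity)]
  calc _ ≤ 1 / (n : ℝ) * ∑ _i : Fin n, L := by
        gcongr
        exact (norm_sum_le _ _).trans
          (sum_le_sum fun i _ => norm_gradient_le_of_lipschitzWith hL (hLip i) w)
    _ = L := by simp; field_simp

theorem measurable_gradient {g : EuclideanSpace ℝ (Fin d) → ℝ} : Measurable (gradient g) :=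
  (InnerProductSpace.toDual ℝ (EuclideanSpace ℝ (Fin d))).symm.continuous.measurable.comp
    (measurable_fderiv ℝ g)

end Gradients

/-! ### Descent along the noisy iterates -/

section Descent

variable {d n T : ℕ} {X : Type*} {f : EuclideanSpace ℝ (Fin d) → X → ℝ} {S : Fin n → X}

theorem noisyIterate_zero (η : Fin T → ℝ) (w₀ : EuclideanSpace ℝ (Fin d))
    (ω : Fin T → Fin n × EuclideanSpace ℝ (Fin d)) : noisyIterate f S η w₀ ω 0 = w₀ := rfl

theorem noisyIterate_succ (η : Fin T → ℝ) (w₀ : EuclideanSpace ℝ (Fin d))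
    (ω : Fin T → Fin n × EuclideanSpace ℝ (Fin d)) (t : Fin T) :
    noisyIterate f S η w₀ ω t.succ = noisyIterate f S η w₀ ω t.castSucc -
      η t • (gradient (fun u => f u (S (ω t).1)) (noisyIterate f S η w₀ ω t.castSucc)
        + (ω t).2) := by
  simp [noisyIterate, Fin.induction_succ]

/-- The iterates after the first step are the iterates started at `w₁` along the remaining
draws. -/
theorem noisyIterate_cons (η : Fin (T + 1) → ℝ) (w₀ : EuclideanSpace ℝ (Fin d))
    (ω : Fin (T + 1) → Fin n × EuclideanSpace ℝ (Fin d)) (k : Fin (T + 1)) :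
    noisyIterate f S η w₀ ω k.succ = noisyIterate f S (Fin.tail η)
      (w₀ - η 0 • (gradient (fun u => f u (S (ω 0).1)) w₀ + (ω 0).2)) (Fin.tail ω) k := by
  induction k using Fin.induction with
  | zero =>
    rw [noisyIterate_succ]
    rfl
  | succ k ih =>
    rw [noisyIterate_succ, noisyIterate_succ, ← ih, ← Fin.succ_castSucc]
    rfl

/-- The stochastic term of the descent inequality at the point `w`, for the draw `p` of a data
index and a noise vector and for the step size `h`: with `N` the deviation of the noisy stochastic
gradient from `∇F(w)`, it is `-(1 - β h) ⟪∇F(w), N⟫ + β h ‖z‖²`. -/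
noncomputable def stochasticDrift (β h : ℝ) (f : EuclideanSpace ℝ (Fin d) → X → ℝ) (S : Fin n → X)
    (w : EuclideanSpace ℝ (Fin d)) (p : Fin n × EuclideanSpace ℝ (Fin d)) : ℝ :=
  -(1 - β * h) * inner ℝ (gradient (empiricalRisk f S) w)
    (gradient (fun u => f u (S p.1)) w - gradient (empiricalRisk f S) w + p.2)
    + β * h * ‖p.2‖ ^ 2

theorem half_sq_norm_gradient_le {L β h : ℝ} (hL : 0 ≤ L) (hβ : 0 < β) (hn : 1 ≤ n)
    (hh : 0 < h) (hβh : β * h ≤ 1)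
    (hLip : ∀ i, LipschitzWith L.toNNReal fun w => f w (S i))
    (hf : ∀ i, IsBetaSmooth β fun w => f w (S i))
    (w : EuclideanSpace ℝ (Fin d)) (p : Fin n × EuclideanSpace ℝ (Fin d)) :
    1 / 2 * ‖gradient (empiricalRisk f S) w‖ ^ 2 ≤
      (empiricalRisk f S w -
        empiricalRisk f S (w - h • (gradient (fun u => f u (S p.1)) w + p.2))) / h
      + stochasticDrift β h f S w p + 4 * β * h * L ^ 2 := by
  set v := gradient (empiricalRisk f S) w with hv
  set e := gradient (fun u => f u (S p.1)) w - v with he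
  have hg : gradient (fun u => f u (S p.1)) w + p.2 = v + (e + p.2) := by rw [he]; abel
  rw [hg, stochasticDrift, ← hv, ← he]
  have hsm := (isBetaSmooth_empiricalRisk hn hf).2 (w - h • (v + (e + p.2))) w
  rw [← hv, sub_sub_cancel_left, inner_neg_right, norm_neg, norm_smul, Real.norm_of_nonneg hh.le,
    real_inner_smul_right, inner_add_right, real_inner_self_eq_norm_sq, mul_pow,
    norm_add_sq_real v] at hsm
  have h1 := (abs_le.1 hsm).2
  have hv1 : ‖v‖ ≤ L := norm_gradient_empiricalRisk_le hL hn (fun i => (hf i).1) hLip w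
  have he1 : ‖e‖ ≤ 2 * L := by
    have := norm_gradient_le_of_lipschitzWith hL (hLip p.1) w
    have := norm_sub_le (gradient (fun u => f u (S p.1)) w) v
    linarith
  have he2 : ‖e‖ ^ 2 ≤ 4 * L ^ 2 := by
    have := pow_le_pow_left₀ (norm_nonneg e) he1 2
    linarith
  have hN : ‖e + p.2‖ ^ 2 ≤ 8 * L ^ 2 + 2 * ‖p.2‖ ^ 2 := by
    have := pow_le_pow_left₀ (norm_nonneg _) (norm_add_le e p.2) 2
    nlinarith [sq_nonneg (‖e‖ - ‖p.2‖)]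
  have h2 : β / 2 * (h ^ 2 * ‖e + p.2‖ ^ 2) ≤ β / 2 * (h ^ 2 * (8 * L ^ 2 + 2 * ‖p.2‖ ^ 2)) := by
    gcongr
  have h3 : 0 ≤ h * (1 - β * h) * ‖v‖ ^ 2 := by
    have : 0 ≤ 1 - β * h := by linarith
    positivity
  have key : 1 / 2 * ‖v‖ ^ 2 * h ≤
      (empiricalRisk f S w - empiricalRisk f S (w - h • (v + (e + p.2))))
      + (-(1 - β * h) * inner ℝ v (e + p.2) + β * h * ‖p.2‖ ^ 2 + 4 * β * h * L ^ 2) * h := by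
    nlinarith
  rw [add_assoc, div_add' _ _ _ hh.ne', le_div_iff₀ hh]
  exact key

/-- The summed descent inequality, for the iterates `w₁, …, w_T`. Replacing `w₀` by `w_T` in the sum
costs at most `L ^ 2`. -/
theorem sum_sq_norm_gradient_le {L β h : ℝ} (hL : 0 ≤ L) (hβ : 0 < β) (hn : 1 ≤ n)
    (hh : 0 < h) (hβh : β * h ≤ 1)
    (hLip : ∀ i, LipschitzWith L.toNNReal fun w => f w (S i))
    (hf : ∀ i, IsBetaSmooth β fun w => f w (S i))
    (hbdd : BddBelow (Set.range (empiricalRisk f S)))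
    (w₀ : EuclideanSpace ℝ (Fin d)) (ω : Fin T → Fin n × EuclideanSpace ℝ (Fin d)) :
    ∑ t : Fin T, ‖gradient (empiricalRisk f S)
        (noisyIterate f S (fun _ => h) w₀ ω t.succ)‖ ^ 2 ≤
      2 * (empiricalRisk f S w₀ - ⨅ w, empiricalRisk f S w) / h
      + 2 * ∑ t : Fin T, stochasticDrift β h f S
          (noisyIterate f S (fun _ => h) w₀ ω t.castSucc) (ω t)
      + 8 * β * h * L ^ 2 * T + L ^ 2 := by
  set W := noisyIterate f S (fun _ => h) w₀ ω with hW
  have tele : ∀ g : Fin (T + 1) → ℝ,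
      ∑ t : Fin T, g t.succ = ∑ t : Fin T, g t.castSucc + g (Fin.last T) - g 0 := fun g => by
    linarith [Fin.sum_univ_succ g, Fin.sum_univ_castSucc g]
  have step : ∀ t : Fin T, 1 / 2 * ‖gradient (empiricalRisk f S) (W t.castSucc)‖ ^ 2 ≤
      (empiricalRisk f S (W t.castSucc) - empiricalRisk f S (W t.succ)) / h
      + stochasticDrift β h f S (W t.castSucc) (ω t) + 4 * β * h * L ^ 2 := fun t => by
    rw [hW, noisyIterate_succ]
    exact half_sq_norm_gradient_le hL hβ hn hh hβh hLip hf _ _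
  have hsum := sum_le_sum fun t (_ : t ∈ (univ : Finset (Fin T))) => step t
  rw [← mul_sum, sum_add_distrib, sum_add_distrib, ← sum_div, sum_sub_distrib,
    tele fun t => empiricalRisk f S (W t)] at hsum
  simp only [sum_const, card_univ, Fintype.card_fin, nsmul_eq_mul] at hsum
  have hlast : ‖gradient (empiricalRisk f S) (W (Fin.last T))‖ ^ 2 ≤ L ^ 2 :=
    pow_le_pow_left₀ (norm_nonneg _)
      (norm_gradient_empiricalRisk_le hL hn (fun i => (hf i).1) hLip _) 2
  have hinf : ⨅ w, empiricalRisk f S w ≤ empiricalRisk f S (W (Fin.last T)) := ciInf_le hbdd _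
  have hgap : (∑ t : Fin T, empiricalRisk f S (W t.castSucc)
      - (∑ t : Fin T, empiricalRisk f S (W t.castSucc) + empiricalRisk f S (W (Fin.last T))
        - empiricalRisk f S (W 0))) / h
      ≤ (empiricalRisk f S w₀ - ⨅ w, empiricalRisk f S w) / h := by
    have : W 0 = w₀ := rfl
    rw [this]
    exact div_le_div_of_nonneg_right (by linarith) hh.le
  rw [tele fun t => ‖gradient (empiricalRisk f S) (W t)‖ ^ 2, mul_div_assoc]
  have := sq_nonneg ‖gradient (empiricalRisk f S) (W 0)‖
  linarith

end Descent

/-! ### Exponential moments of the noise -/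

section Noise

variable {d n : ℕ} {L ε δ : ℝ}

/-- The rate `b` of the Gaussian weight `exp(-b ‖z‖²)` of the noise. -/
noncomputable def noiseRate (n : ℕ) (L ε δ : ℝ) : ℝ :=
  ε ^ 2 / (8 * L ^ 2 * Real.log (3 * n / δ) * Real.log (2 / δ))

theorem noiseWeight_eq (z : EuclideanSpace ℝ (Fin d)) :
    noiseWeight d n L ε δ z = Real.exp (-noiseRate n L ε δ * ‖z‖ ^ 2) := by
  rw [noiseWeight, noiseRate]
  ring_nf

/-- The moment generating function of a spherical Gaussian, before normalisation. -/
theorem integral_exp_neg_mul_sq_norm_add_inner {b : ℝ} (hb : 0 < b)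
    (u : EuclideanSpace ℝ (Fin d)) :
    Integrable (fun z : EuclideanSpace ℝ (Fin d) => Real.exp (-b * ‖z‖ ^ 2 + inner ℝ u z)) ∧
    ∫ z : EuclideanSpace ℝ (Fin d), Real.exp (-b * ‖z‖ ^ 2 + inner ℝ u z) =
      (Real.pi / b) ^ (d / 2 : ℝ) * Real.exp (‖u‖ ^ 2 / (4 * b)) := by
  have hbC : 0 < (b : ℂ).re := hb
  have hfun : (fun z : EuclideanSpace ℝ (Fin d) =>
      Complex.exp (-(b : ℂ) * ‖z‖ ^ 2 + 1 * (inner ℝ u z : ℝ))) =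
      fun z => ((Real.exp (-b * ‖z‖ ^ 2 + inner ℝ u z) : ℝ) : ℂ) := by
    ext z
    push_cast
    ring_nf
  have hint := GaussianFourier.integrable_cexp_neg_mul_sq_norm_add hbC 1 u
  have hval := GaussianFourier.integral_cexp_neg_mul_sq_norm_add hbC 1 u
  rw [hfun] at hint
  simp only [congrFun hfun] at hval
  refine ⟨by simpa only [RCLike.re_to_complex, Complex.ofReal_re] using hint.re, ?_⟩
  rw [integral_complex_ofReal] at hval
  apply Complex.ofReal_injective
  rw [hval, Complex.ofReal_mul, Complex.ofReal_cpow (by positivity)]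
  push_cast
  simp

theorem noise_lintegral_eq (hb : 0 < noiseRate n L ε δ) {c : ℝ} (hc : c < noiseRate n L ε δ)
    (u : EuclideanSpace ℝ (Fin d)) :
    ∫⁻ z, ENNReal.ofReal (Real.exp (inner ℝ u z + c * ‖z‖ ^ 2)) ∂(noiseLaw d n L ε δ) =
      ENNReal.ofReal ((noiseRate n L ε δ / (noiseRate n L ε δ - c)) ^ (d / 2 : ℝ) *
        Real.exp (‖u‖ ^ 2 / (4 * (noiseRate n L ε δ - c)))) := by
  set b := noiseRate n L ε δ with hbdef
  have hbc : 0 < b - c := sub_pos.2 hc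
  have hZ : ∫ y, noiseWeight d n L ε δ y = (Real.pi / b) ^ (d / 2 : ℝ) := by
    simpa [noiseWeight_eq, ← hbdef] using
      (integral_exp_neg_mul_sq_norm_add_inner hb (0 : EuclideanSpace ℝ (Fin d))).2
  have hZpos : 0 < (Real.pi / b) ^ (d / 2 : ℝ) := by positivity
  have hmeas : Measurable fun z : EuclideanSpace ℝ (Fin d) => ENNReal.ofReal
      (noiseWeight d n L ε δ z / ∫ y, noiseWeight d n L ε δ y) := by
    simp only [noiseWeight_eq]
    fun_prop
  have hint := integral_exp_neg_mul_sq_norm_add_inner hbc u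
  rw [noiseLaw, lintegral_withDensity_eq_lintegral_mul _ hmeas (by fun_prop)]
  have hprod : ∀ z : EuclideanSpace ℝ (Fin d),
      ((fun z => ENNReal.ofReal (noiseWeight d n L ε δ z / ∫ y, noiseWeight d n L ε δ y)) *
        fun z => ENNReal.ofReal (Real.exp (inner ℝ u z + c * ‖z‖ ^ 2))) z =
      ENNReal.ofReal (((Real.pi / b) ^ (d / 2 : ℝ))⁻¹ *
        Real.exp (-(b - c) * ‖z‖ ^ 2 + inner ℝ u z)) := fun z => by
    rw [Pi.mul_apply, ← ENNReal.ofReal_mul' (Real.exp_pos _).le, hZ, noiseWeight_eq, ← hbdef,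
      div_mul_eq_mul_div, ← Real.exp_add, div_eq_inv_mul]
    ring_nf
  simp only [hprod]
  rw [← ofReal_integral_eq_lintegral_ofReal (hint.1.const_mul _)
    (Filter.Eventually.of_forall fun z => by positivity), integral_const_mul, hint.2, ← mul_assoc]
  congr 2
  rw [← Real.inv_rpow (by positivity), ← Real.mul_rpow (by positivity) (by positivity)]
  congr 1
  field_simp

theorem isProbabilityMeasure_noiseLaw (hb : 0 < noiseRate n L ε δ) :
    IsProbabilityMeasure (noiseLaw d n L ε δ) := by
  constructor
  have h := noise_lintegral_eq (d := d) hb hb 0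
  simpa [hb.ne'] using h

theorem noise_lintegral_le (hb : 0 < noiseRate n L ε δ) {c : ℝ} (hc0 : 0 ≤ c)
    (hc : c ≤ noiseRate n L ε δ / 2) (u : EuclideanSpace ℝ (Fin d)) :
    ∫⁻ z, ENNReal.ofReal (Real.exp (inner ℝ u z + c * ‖z‖ ^ 2)) ∂(noiseLaw d n L ε δ) ≤
      ENNReal.ofReal (Real.exp (c * d / noiseRate n L ε δ
        + ‖u‖ ^ 2 / (2 * noiseRate n L ε δ))) := by
  rw [noise_lintegral_eq hb (by linarith)]
  set b := noiseRate n L ε δ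
  have hbc : 0 < b - c := by linarith
  apply ENNReal.ofReal_le_ofReal
  rw [Real.exp_add]
  -- `b / (b - c) ≤ 1 + 2 c / b ≤ exp (2 c / b)` because `c ≤ b / 2`
  have h1 : b / (b - c) ≤ Real.exp (2 * c / b) := by
    refine le_trans ?_ (Real.add_one_le_exp _)
    rw [div_le_iff₀ hbc]
    have : (2 * c / b + 1) * (b - c) - b = c * (b - 2 * c) / b := by field_simp; ring
    have : 0 ≤ c * (b - 2 * c) / b := div_nonneg (mul_nonneg hc0 (by linarith)) hb.le
    linarith
  have h2 : (b / (b - c)) ^ (d / 2 : ℝ) ≤ Real.exp (c * d / b) := by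
    calc _ ≤ Real.exp (2 * c / b) ^ (d / 2 : ℝ) := by gcongr
      _ = Real.exp (c * d / b) := by rw [← Real.exp_mul]; ring_nf
  have h3 : ‖u‖ ^ 2 / (4 * (b - c)) ≤ ‖u‖ ^ 2 / (2 * b) :=
    div_le_div_of_nonneg_left (sq_nonneg _) (by positivity) (by linarith)
  gcongr

end Noise

/-! ### Exponential moment of one step -/

section OneStep

variable {d n : ℕ} {X : Type*} {f : EuclideanSpace ℝ (Fin d) → X → ℝ} {S : Fin n → X}

theorem isProbabilityMeasure_uniformOn_fin (hn : 1 ≤ n) :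
    IsProbabilityMeasure (uniformOn (Set.univ : Set (Fin n))) :=
  have : Nonempty (Fin n) := Fin.pos_iff_nonempty.1 hn
  isProbabilityMeasure_uniformOn Set.finite_univ Set.univ_nonempty

theorem integral_uniformOn_fin (hn : 1 ≤ n) (x : Fin n → ℝ) :
    ∫ i, x i ∂(uniformOn (Set.univ : Set (Fin n))) = (1 / (n : ℝ)) * ∑ i, x i := by
  have := isProbabilityMeasure_uniformOn_fin hn
  rw [integral_fintype (Integrable.of_finite), mul_sum]
  refine sum_congr rfl fun i _ => ?_
  rw [Measure.real, uniformOn_univ]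
  simp

/-- The sampling error of the stochastic gradient has mean zero and bounded inner product with
`∇F(w)`, so Hoeffding's lemma bounds its exponential moments. -/
theorem sampling_lintegral_le {L t : ℝ} (hL : 0 ≤ L) (hn : 1 ≤ n)
    (hf : ∀ i, Differentiable ℝ fun w => f w (S i))
    (hLip : ∀ i, LipschitzWith L.toNNReal fun w => f w (S i))
    (w : EuclideanSpace ℝ (Fin d)) :
    ∫⁻ i, ENNReal.ofReal (Real.exp (t * inner ℝ (gradient (empiricalRisk f S) w)
        (gradient (fun u => f u (S i)) w - gradient (empiricalRisk f S) w)))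
        ∂(uniformOn (Set.univ : Set (Fin n))) ≤
      ENNReal.ofReal (Real.exp (2 * L ^ 4 * t ^ 2)) := by
  have := isProbabilityMeasure_uniformOn_fin hn
  have hn0 : (0 : ℝ) < n := by exact_mod_cast hn
  set v := gradient (empiricalRisk f S) w with hv
  have hv1 : ‖v‖ ≤ L := norm_gradient_empiricalRisk_le hL hn hf hLip w
  set x : Fin n → ℝ := fun i => inner ℝ v (gradient (fun u => f u (S i)) w - v) with hx
  have hbound : ∀ i, x i ∈ Set.Icc (-(2 * L ^ 2)) (2 * L ^ 2) := fun i => by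
    rw [Set.mem_Icc, ← abs_le]
    have he : ‖gradient (fun u => f u (S i)) w - v‖ ≤ 2 * L := by
      have := norm_gradient_le_of_lipschitzWith hL (hLip i) w
      have := norm_sub_le (gradient (fun u => f u (S i)) w) v
      linarith
    calc |x i| ≤ ‖v‖ * ‖gradient (fun u => f u (S i)) w - v‖ := abs_real_inner_le_norm _ _
      _ ≤ L * (2 * L) := by gcongr
      _ = 2 * L ^ 2 := by ring
  have hmean : ∫ i, x i ∂(uniformOn (Set.univ : Set (Fin n))) = 0 := by
    rw [integral_uniformOn_fin hn, hx, ← inner_sum, sum_sub_distrib, ← real_inner_smul_right,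
      smul_sub, ← gradient_empiricalRisk hf, ← hv]
    simp [← Nat.cast_smul_eq_nsmul ℝ, smul_smul, hn0.ne']
  have hsub := hasSubgaussianMGF_of_mem_Icc_of_integral_eq_zero
    (μ := uniformOn (Set.univ : Set (Fin n))) (measurable_of_finite x).aemeasurable
    (Filter.Eventually.of_forall hbound) hmean
  rw [← ofReal_integral_eq_lintegral_ofReal (hsub.integrable_exp_mul t)
    (Filter.Eventually.of_forall fun i => (Real.exp_pos _).le)]
  refine ENNReal.ofReal_le_ofReal ((hsub.mgf_le t).trans (Real.exp_le_exp.2 (le_of_eq ?_)))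
  push_cast
  rw [Real.norm_of_nonneg (by nlinarith [sq_nonneg L])]
  ring

theorem stochasticDrift_lintegral_le {L ε δ β h r : ℝ} (hL : 0 ≤ L) (hn : 1 ≤ n)
    (hb : 0 < noiseRate n L ε δ) (hβh0 : 0 ≤ β * h) (hβh : β * h ≤ 1) (hr : 0 ≤ r)
    (hrb : r * (β * h) ≤ noiseRate n L ε δ / 2)
    (hf : ∀ i, Differentiable ℝ fun w => f w (S i))
    (hLip : ∀ i, LipschitzWith L.toNNReal fun w => f w (S i))
    (w : EuclideanSpace ℝ (Fin d)) :
    ∫⁻ p, ENNReal.ofReal (Real.exp (r * stochasticDrift β h f S w p))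
        ∂((uniformOn (Set.univ : Set (Fin n))).prod (noiseLaw d n L ε δ)) ≤
      ENNReal.ofReal (Real.exp (2 * L ^ 4 * r ^ 2 + (r * (β * h) * d / noiseRate n L ε δ
        + r ^ 2 * L ^ 2 / (2 * noiseRate n L ε δ)))) := by
  have := isProbabilityMeasure_uniformOn_fin hn
  have := isProbabilityMeasure_noiseLaw (d := d) hb
  set v := gradient (empiricalRisk f S) w with hv
  have hv1 : ‖v‖ ≤ L := norm_gradient_empiricalRisk_le hL hn hf hLip w
  set t := -(r * (1 - β * h)) with ht
  have ht2 : t ^ 2 ≤ r ^ 2 := by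
    rw [ht, neg_sq, mul_pow]
    have : (1 - β * h) ^ 2 ≤ 1 := by nlinarith
    nlinarith [sq_nonneg r]
  have hsplit : ∀ p : Fin n × EuclideanSpace ℝ (Fin d),
      ENNReal.ofReal (Real.exp (r * stochasticDrift β h f S w p)) =
      ENNReal.ofReal (Real.exp (t * inner ℝ v (gradient (fun u => f u (S p.1)) w - v))) *
        ENNReal.ofReal (Real.exp (inner ℝ (t • v) p.2 + r * (β * h) * ‖p.2‖ ^ 2)) := fun p => by
    rw [← ENNReal.ofReal_mul (Real.exp_pos _).le, ← Real.exp_add, stochasticDrift, ← hv,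
      inner_add_right, real_inner_smul_left, ht]
    ring_nf
  simp only [hsplit]
  rw [lintegral_prod_mul (f := fun i => ENNReal.ofReal
    (Real.exp (t * inner ℝ v (gradient (fun u => f u (S i)) w - v))))
    (g := fun z => ENNReal.ofReal (Real.exp (inner ℝ (t • v) z + r * (β * h) * ‖z‖ ^ 2)))
    (measurable_of_finite _).aemeasurable (by fun_prop),
    Real.exp_add, ENNReal.ofReal_mul (Real.exp_pos _).le]
  gcongr ?_ * ?_
  · refine (sampling_lintegral_le hL hn hf hLip w).trans (ENNReal.ofReal_le_ofReal ?_)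
    gcongr
  · refine (noise_lintegral_le hb (mul_nonneg hr hβh0) hrb _).trans (ENNReal.ofReal_le_ofReal ?_)
    have : ‖t • v‖ ^ 2 ≤ r ^ 2 * L ^ 2 := by
      rw [norm_smul, mul_pow, Real.norm_eq_abs, sq_abs]
      gcongr
    gcongr

end OneStep

/-! ### Concentration along the iterates -/

section Concentration

variable {d n T : ℕ} {X : Type*} {f : EuclideanSpace ℝ (Fin d) → X → ℝ} {S : Fin n → X}

/-- A bound for `∫ ψ(w, ·)` that is uniform in `w` multiplies along the iterates: the draws are
independent, and the first step only changes the initial point of the remaining ones. -/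
theorem lintegral_prod_noisyIterate_le (ν : Measure (Fin n × EuclideanSpace ℝ (Fin d)))
    [IsProbabilityMeasure ν]
    (ψ : EuclideanSpace ℝ (Fin d) → Fin n × EuclideanSpace ℝ (Fin d) → ℝ≥0∞) {A : ℝ≥0∞}
    (hA : A ≠ ∞) (hψt : ∀ w p, ψ w p ≠ ∞) (hψ : ∀ w, ∫⁻ p, ψ w p ∂ν ≤ A) (η : Fin T → ℝ)
    (w₀ : EuclideanSpace ℝ (Fin d)) :
    ∫⁻ ω, ∏ t, ψ (noisyIterate f S η w₀ ω t.castSucc) (ω t) ∂(Measure.pi fun _ => ν) ≤ A ^ T := by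
  induction T generalizing w₀ with
  | zero => simp
  | succ T ih =>
    have hmp := (measurePreserving_piFinSuccAbove
      (fun _ : Fin (T + 1) => ν) 0).symm
    rw [← hmp.lintegral_comp_emb (MeasurableEquiv.measurableEmbedding _)]
    refine (lintegral_prod_le _).trans ?_
    have hstep : ∀ (p : Fin n × EuclideanSpace ℝ (Fin d))
        (ω : Fin T → Fin n × EuclideanSpace ℝ (Fin d)),
        ∏ t, ψ (noisyIterate f S η w₀ (Fin.cons p ω) t.castSucc)
          ((Fin.cons p ω : Fin (T + 1) → _) t) =
        ψ w₀ p * ∏ t, ψ (noisyIterate f S (Fin.tail η)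
          (w₀ - η 0 • (gradient (fun u => f u (S p.1)) w₀ + p.2)) ω t.castSucc) (ω t) := by
      intro p ω
      rw [Fin.prod_univ_succ]
      simp only [Fin.castSucc_zero, noisyIterate_zero, Fin.cons_zero, Fin.cons_succ,
        ← Fin.succ_castSucc, noisyIterate_cons, Fin.tail_cons]
    calc _ = ∫⁻ p, ∫⁻ ω, ψ w₀ p * ∏ t, ψ (noisyIterate f S (Fin.tail η)
          (w₀ - η 0 • (gradient (fun u => f u (S p.1)) w₀ + p.2)) ω t.castSucc) (ω t)
            ∂(Measure.pi fun _ => ν) ∂ν := by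
          refine lintegral_congr fun p => lintegral_congr fun ω => ?_
          rw [← hstep]
          simp [MeasurableEquiv.piFinSuccAbove, Fin.insertNthEquiv]
      _ ≤ ∫⁻ p, ψ w₀ p * A ^ T ∂ν := by
          refine lintegral_mono fun p => ?_
          rw [lintegral_const_mul' _ _ (hψt _ _)]
          gcongr
          exact ih _ _
      _ ≤ A ^ (T + 1) := by
          rw [lintegral_mul_const' _ _ (ENNReal.pow_ne_top hA), pow_succ']
          gcongr
          exact hψ w₀

theorem measurable_gradient_sample :
    Measurable fun q : EuclideanSpace ℝ (Fin d) × Fin n =>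
      gradient (fun u => f u (S q.2)) q.1 :=
  measurable_from_prod_countable_left fun i => measurable_gradient (g := fun u => f u (S i))

theorem measurable_noisyIterate (η : Fin T → ℝ) (w₀ : EuclideanSpace ℝ (Fin d))
    (k : Fin (T + 1)) : Measurable fun ω => noisyIterate f S η w₀ ω k := by
  induction k using Fin.induction with
  | zero => exact measurable_const
  | succ k ih =>
    simp only [noisyIterate_succ]
    have hg : Measurable fun ω : Fin T → Fin n × EuclideanSpace ℝ (Fin d) =>
        gradient (fun u => f u (S (ω k).1)) (noisyIterate f S η w₀ ω k.castSucc) :=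
      measurable_gradient_sample.comp (ih.prodMk (measurable_pi_apply k).fst)
    have hz : Measurable fun ω : Fin T → Fin n × EuclideanSpace ℝ (Fin d) => (ω k).2 :=
      (measurable_pi_apply k).snd
    fun_prop

theorem measurable_stochasticDrift_noisyIterate (β h : ℝ) (η : Fin T → ℝ)
    (w₀ : EuclideanSpace ℝ (Fin d)) (t : Fin T) :
    Measurable fun ω => stochasticDrift β h f S (noisyIterate f S η w₀ ω t.castSucc) (ω t) := by
  unfold stochasticDrift
  have h1 := measurable_noisyIterate (f := f) (S := S) η w₀ t.castSucc
  have h2 : Measurable fun ω : Fin T → Fin n × EuclideanSpace ℝ (Fin d) =>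
      gradient (fun u => f u (S (ω t).1)) (noisyIterate f S η w₀ ω t.castSucc) :=
    measurable_gradient_sample.comp (h1.prodMk (measurable_pi_apply t).fst)
  have h3 : Measurable fun ω => gradient (empiricalRisk f S)
      (noisyIterate f S η w₀ ω t.castSucc) := measurable_gradient.comp h1
  have h4 : Measurable fun ω : Fin T → Fin n × EuclideanSpace ℝ (Fin d) => (ω t).2 :=
    (measurable_pi_apply t).snd
  exact ((h3.inner ((h2.sub h3).add h4)).const_mul _).add ((h4.norm.pow_const 2).const_mul _)

/-- The Chernoff bound for the sum of the stochastic terms along the iterates. -/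
theorem sum_stochasticDrift_tail {L ε δ β h r γ c : ℝ} (hn : 1 ≤ n)
    (hb : 0 < noiseRate n L ε δ) (hr : 0 < r) (hγ : 0 < γ)
    (hc : ∀ w, ∫⁻ p, ENNReal.ofReal (Real.exp (r * stochasticDrift β h f S w p))
        ∂((uniformOn (Set.univ : Set (Fin n))).prod (noiseLaw d n L ε δ)) ≤
      ENNReal.ofReal (Real.exp c))
    (w₀ : EuclideanSpace ℝ (Fin d)) :
    1 - γ ≤ (drawsLaw d n L ε δ).real
      {ω | ∑ t, stochasticDrift β h f S
          (noisyIterate f S (fun _ => h) w₀ ω t.castSucc) (ω t) ≤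
        ((n ^ 2 : ℕ) * c + Real.log (1 / γ)) / r} := by
  have := isProbabilityMeasure_uniformOn_fin hn
  have := isProbabilityMeasure_noiseLaw (d := d) hb
  have : IsProbabilityMeasure (drawsLaw d n L ε δ) := by unfold drawsLaw; infer_instance
  set Y : (Fin (n ^ 2) → Fin n × EuclideanSpace ℝ (Fin d)) → ℝ := fun ω =>
    ∑ t, stochasticDrift β h f S (noisyIterate f S (fun _ => h) w₀ ω t.castSucc) (ω t) with hY
  have hYm : Measurable Y :=
    Finset.measurable_sum _ fun t _ => measurable_stochasticDrift_noisyIterate _ _ _ _ t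
  set a := (n ^ 2 : ℕ) * c + Real.log (1 / γ) with ha
  have hmom : ∫⁻ ω, ENNReal.ofReal (Real.exp (r * Y ω)) ∂(drawsLaw d n L ε δ) ≤
      ENNReal.ofReal (Real.exp ((n ^ 2 : ℕ) * c)) := by
    have h1 := lintegral_prod_noisyIterate_le (f := f) (S := S)
      ((uniformOn (Set.univ : Set (Fin n))).prod (noiseLaw d n L ε δ))
      (fun w p => ENNReal.ofReal (Real.exp (r * stochasticDrift β h f S w p)))
      ENNReal.ofReal_ne_top (fun _ _ => ENNReal.ofReal_ne_top) hc
      (fun _ : Fin (n ^ 2) => h) w₀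
    rw [← ENNReal.ofReal_pow (Real.exp_pos _).le, ← Real.exp_nat_mul] at h1
    refine le_trans (le_of_eq (lintegral_congr fun ω => ?_)) h1
    rw [← ENNReal.ofReal_prod_of_nonneg fun _ _ => (Real.exp_pos _).le, ← Real.exp_sum, hY,
      mul_sum]
  have hmarkov := meas_ge_le_lintegral_div (μ := drawsLaw d n L ε δ)
    (f := fun ω => ENNReal.ofReal (Real.exp (r * Y ω))) (by fun_prop)
    (ε := ENNReal.ofReal (Real.exp a)) (by simp [Real.exp_pos]) ENNReal.ofReal_ne_top
  have hbad : (drawsLaw d n L ε δ) {ω | a / r < Y ω} ≤ ENNReal.ofReal γ := by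
    refine (measure_mono fun ω hω => ?_).trans
      (hmarkov.trans ((ENNReal.div_le_div_right hmom _).trans (le_of_eq ?_)))
    · have : a < r * Y ω := by
        have := (div_lt_iff₀ hr).1 hω
        linarith
      exact ENNReal.ofReal_le_ofReal (Real.exp_le_exp.2 this.le)
    · rw [← ENNReal.ofReal_div_of_pos (Real.exp_pos _), ← Real.exp_sub, ha, sub_add_cancel_left,
        one_div, Real.log_inv, neg_neg, Real.exp_log hγ]
  have hset : {ω | Y ω ≤ a / r} = {ω | a / r < Y ω}ᶜ := by
    ext ω
    simp
  rw [hset, probReal_compl_eq_one_sub (measurableSet_lt measurable_const hYm)]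
  have := ENNReal.toReal_mono ENNReal.ofReal_ne_top hbad
  rw [ENNReal.toReal_ofReal hγ.le] at this
  simp only [Measure.real]
  linarith

end Concentration

/-! ### The choice of the parameters -/

section Parameters

/-- The Chernoff parameter `Λ / (n K ρ)` with `K = 4 β D + 1` meets the constraint under which the
Gaussian exponential moment is controlled, for the noise rate `1 / (2 ρ²)`. -/
theorem chernoff_parameter_le {β D G h n ρ σ Λ : ℝ} (hβ : 0 < β) (hG : 0 < G) (hGD : G ≤ D)
    (hn : 1 ≤ n) (hρ : 0 < ρ) (hσ : ρ ≤ σ) (hΛ : 0 < Λ) (hΛn : Λ ≤ n) (hh : h ≤ G / (σ * n)) :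
    Λ / (n * (4 * β * D + 1) * ρ) * (β * h) ≤ 1 / (2 * ρ ^ 2) / 2 := by
  have hD : 0 < D := hG.trans_le hGD
  have hσ0 : 0 < σ := hρ.trans_le hσ
  have hn0 : 0 < n := by linarith
  have h1 : h ≤ D / ρ := hh.trans (by
    have : ρ ≤ σ * n := by nlinarith
    gcongr)
  have h2 : Λ / (n * (4 * β * D + 1) * ρ) ≤ 1 / ((4 * β * D + 1) * ρ) := by
    rw [div_le_div_iff₀ (by positivity) (by positivity)]
    have : 0 < (4 * β * D + 1) * ρ := by positivity
    nlinarith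
  calc _ ≤ Λ / (n * (4 * β * D + 1) * ρ) * (β * (D / ρ)) := by gcongr
    _ ≤ 1 / ((4 * β * D + 1) * ρ) * (β * (D / ρ)) := by gcongr
    _ = β * D / ((4 * β * D + 1) * ρ ^ 2) := by field_simp
    _ ≤ 1 / (2 * ρ ^ 2) / 2 := by
      rw [div_div, div_le_div_iff₀ (by positivity) (by positivity)]
      nlinarith [sq_nonneg ρ]

/-- Every term of the averaged descent inequality is of order `√d Λ ρ / n`, where `q = √d`, the
noise rate is `1 / (2 ρ²)`, and `Λ = √(log (1 / γ))` is bounded below by `l`. -/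
theorem averaged_bound_le {L β D G h n q ρ σ Λ l : ℝ} (hL : 0 < L) (hβ : 0 < β) (hG : 0 < G)
    (hGD : G ≤ D) (hn : 1 ≤ n) (hq : 1 ≤ q) (hρ : L ≤ ρ) (hσ : q * ρ ≤ σ) (hσL : 2 * L ≤ σ)
    (hσ' : σ ≤ 2 * (q * ρ)) (hl : 0 < l) (hΛ : l ≤ Λ)
    (hh : h = min (1 / β) (G / (σ * n))) :
    1 / n ^ 2 * (β * G ^ 2 / h
      + 2 * ((n ^ 2 * (2 * L ^ 4 * (Λ / (n * (4 * β * D + 1) * ρ)) ^ 2 +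
        (Λ / (n * (4 * β * D + 1) * ρ) * (β * h) * q ^ 2 / (1 / (2 * ρ ^ 2))
          + (Λ / (n * (4 * β * D + 1) * ρ)) ^ 2 * L ^ 2 / (2 * (1 / (2 * ρ ^ 2)))))
        + Λ ^ 2) / (Λ / (n * (4 * β * D + 1) * ρ)))
      + 8 * β * h * L ^ 2 * n ^ 2 + L ^ 2) ≤
    (β ^ 2 * D ^ 2 / (l * L) + 14 * β * D / l + 6 * L ^ 2 + 2 * (4 * β * D + 1) + L / l) *
      (q * Λ * ρ / n) := by
  have hD : 0 < D := hG.trans_le hGD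
  have hρ0 : 0 < ρ := hL.trans_le hρ
  have hσ0 : 0 < σ := by linarith
  have hn0 : 0 < n := by linarith
  have hΛ0 : 0 < Λ := hl.trans_le hΛ
  have hq0 : 0 < q := by linarith
  have hh0 : 0 < h := by rw [hh]; exact lt_min (by positivity) (by positivity)
  have hhG : h ≤ G / (σ * n) := hh ▸ min_le_right _ _
  set K := 4 * β * D + 1 with hK
  have hK1 : 1 ≤ K := by rw [hK]; nlinarith [mul_pos hβ hD]
  have hK0 : 0 < K := by linarith
  set U := q * Λ * ρ / n with hU
  -- the three comparisons with `U` that all the terms reduce to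
  have hU1 : 1 / n ≤ U / (l * L) := by
    rw [hU, div_div, div_le_div_iff₀ hn0 (by positivity)]
    have h1 : l * L ≤ Λ * ρ := by gcongr
    have h2 : Λ * ρ ≤ q * (Λ * ρ) := le_mul_of_one_le_left (by positivity) hq
    nlinarith
  have hU2 : q * ρ / n ≤ U / l := by
    rw [hU, div_div, div_le_div_iff₀ hn0 (by positivity)]
    have h1 : q * ρ * l ≤ q * ρ * Λ := by gcongr
    nlinarith
  have hU3 : Λ * ρ / n ≤ U := by
    rw [hU]
    gcongr
    nlinarith
  have hn2 : 1 / n ^ 2 ≤ 1 / n := by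
    rw [div_le_div_iff₀ (by positivity) hn0]
    nlinarith
  have hσU : σ / n ≤ 2 * (U / l) := by
    calc σ / n ≤ 2 * (q * ρ) / n := by gcongr
      _ = 2 * (q * ρ / n) := by ring
      _ ≤ _ := by gcongr
  have hinv : 1 / h ≤ β + σ * n / G := by
    rcases min_choice (1 / β) (G / (σ * n)) with hm | hm
    · rw [hh, hm, one_div_one_div]
      have : 0 < σ * n / G := by positivity
      linarith
    · rw [hh, hm, one_div_div]
      linarith
  have t1 : 1 / n ^ 2 * (β * G ^ 2 / h) ≤ β ^ 2 * D ^ 2 * (U / (l * L)) + 2 * β * D * (U / l) := by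
    calc 1 / n ^ 2 * (β * G ^ 2 / h) = 1 / n ^ 2 * (β * G ^ 2) * (1 / h) := by ring
      _ ≤ 1 / n ^ 2 * (β * G ^ 2) * (β + σ * n / G) := by gcongr
      _ = β ^ 2 * G ^ 2 * (1 / n ^ 2) + β * G * (σ / n) := by field_simp
      _ ≤ β ^ 2 * D ^ 2 * (1 / n) + β * D * (2 * (U / l)) := by gcongr
      _ ≤ β ^ 2 * D ^ 2 * (U / (l * L)) + β * D * (2 * (U / l)) := by gcongr
      _ = _ := by ring
  have t2 : 4 * L ^ 4 * (Λ / (n * K * ρ)) ≤ 4 * L ^ 2 * U := by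
    calc 4 * L ^ 4 * (Λ / (n * K * ρ)) ≤ 4 * L ^ 4 * (Λ / (n * 1 * ρ)) := by gcongr
      _ = 4 * L ^ 2 * (L ^ 2 * Λ / (n * ρ)) := by ring
      _ ≤ 4 * L ^ 2 * (ρ ^ 2 * Λ / (n * ρ)) := by gcongr
      _ = 4 * L ^ 2 * (Λ * ρ / n) := by field_simp
      _ ≤ 4 * L ^ 2 * U := by gcongr
  have t3 : 4 * β * h * q ^ 2 * ρ ^ 2 ≤ 8 * β * D * (U / l) := by
    calc 4 * β * h * q ^ 2 * ρ ^ 2 = 4 * β * h * (q * ρ) ^ 2 := by ring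
      _ ≤ 4 * β * (G / (σ * n)) * σ ^ 2 := by gcongr
      _ = 4 * β * G * (σ / n) := by field_simp
      _ ≤ 4 * β * D * (2 * (U / l)) := by gcongr
      _ = _ := by ring
  have t4 : 2 * (Λ / (n * K * ρ)) * L ^ 2 * ρ ^ 2 ≤ 2 * L ^ 2 * U := by
    calc 2 * (Λ / (n * K * ρ)) * L ^ 2 * ρ ^ 2 ≤ 2 * (Λ / (n * 1 * ρ)) * L ^ 2 * ρ ^ 2 := by gcongr
      _ = 2 * L ^ 2 * (Λ * ρ / n) := by field_simp
      _ ≤ 2 * L ^ 2 * U := by gcongr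
  have t5 : 2 * K * (Λ * ρ / n) ≤ 2 * K * U := by gcongr
  have t6 : 8 * β * h * L ^ 2 ≤ 4 * β * D * (U / l) := by
    calc 8 * β * h * L ^ 2 ≤ 8 * β * (G / (σ * n)) * L ^ 2 := by gcongr
      _ ≤ 8 * β * (D / (2 * L * n)) * L ^ 2 := by gcongr
      _ = 4 * β * D * L * (1 / n) := by field_simp; norm_num
      _ ≤ 4 * β * D * L * (U / (l * L)) := by gcongr
      _ = _ := by field_simp
  have t7 : 1 / n ^ 2 * L ^ 2 ≤ L * (U / l) := by
    calc 1 / n ^ 2 * L ^ 2 ≤ U / (l * L) * L ^ 2 :=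
          mul_le_mul_of_nonneg_right (hn2.trans hU1) (sq_nonneg L)
      _ = _ := by field_simp
  have hlhs : 1 / n ^ 2 * (β * G ^ 2 / h
      + 2 * ((n ^ 2 * (2 * L ^ 4 * (Λ / (n * K * ρ)) ^ 2 +
        (Λ / (n * K * ρ) * (β * h) * q ^ 2 / (1 / (2 * ρ ^ 2))
          + (Λ / (n * K * ρ)) ^ 2 * L ^ 2 / (2 * (1 / (2 * ρ ^ 2)))))
        + Λ ^ 2) / (Λ / (n * K * ρ)))
      + 8 * β * h * L ^ 2 * n ^ 2 + L ^ 2) =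
      1 / n ^ 2 * (β * G ^ 2 / h) + 4 * L ^ 4 * (Λ / (n * K * ρ)) + 4 * β * h * q ^ 2 * ρ ^ 2
        + 2 * (Λ / (n * K * ρ)) * L ^ 2 * ρ ^ 2 + 2 * K * (Λ * ρ / n) + 8 * β * h * L ^ 2
        + 1 / n ^ 2 * L ^ 2 := by
    field_simp
    ring
  have hrhs : (β ^ 2 * D ^ 2 / (l * L) + 14 * β * D / l + 6 * L ^ 2 + 2 * K + L / l) * U =
      (β ^ 2 * D ^ 2 * (U / (l * L)) + 2 * β * D * (U / l)) + 4 * L ^ 2 * U + 8 * β * D * (U / l)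
        + 2 * L ^ 2 * U + 2 * K * U + 4 * β * D * (U / l) + L * (U / l) := by
    ring
  rw [hlhs, hrhs]
  linarith

/-- The standard deviation `ρ` of a coordinate of the noise, with `ρ² = 1 / (2 b)`. -/
noncomputable def noiseStd (n : ℕ) (L ε δ : ℝ) : ℝ :=
  2 * L * Real.sqrt (Real.log (3 * n / δ) * Real.log (2 / δ)) / ε

variable {n d : ℕ} {L ε δ : ℝ}

theorem one_le_log_three_mul_div (hn : 1 ≤ n) (hδ : 0 < δ) (hδ1 : δ < 1) :
    1 ≤ Real.log (3 * n / δ) := by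
  have hn0 : (1 : ℝ) ≤ n := by exact_mod_cast hn
  rw [Real.le_log_iff_exp_le (by positivity)]
  have h3 : (3 : ℝ) ≤ 3 * n / δ := by
    rw [le_div_iff₀ hδ]
    nlinarith
  linarith [Real.exp_one_lt_d9]

theorem half_le_log_two_div (hδ : 0 < δ) (hδ1 : δ < 1) : 1 / 2 ≤ Real.log (2 / δ) := by
  have h2 : (2 : ℝ) ≤ 2 / δ := by
    rw [le_div_iff₀ hδ]
    linarith
  have := Real.log_le_log (by norm_num) h2
  linarith [Real.log_two_gt_d9]

theorem sq_noiseStd (hn : 1 ≤ n) (hδ : 0 < δ) (hδ1 : δ < 1) :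
    noiseStd n L ε δ ^ 2 =
      4 * L ^ 2 * Real.log (3 * n / δ) * Real.log (2 / δ) / ε ^ 2 := by
  have h1 := one_le_log_three_mul_div hn hδ hδ1
  have h2 := half_le_log_two_div hδ hδ1
  rw [noiseStd, div_pow, mul_pow, Real.sq_sqrt (mul_nonneg (by linarith) (by linarith))]
  ring

theorem noiseRate_eq (hn : 1 ≤ n) (hδ : 0 < δ) (hδ1 : δ < 1) :
    noiseRate n L ε δ = 1 / (2 * noiseStd n L ε δ ^ 2) := by
  rw [sq_noiseStd hn hδ hδ1, noiseRate, mul_div_assoc', one_div_div]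
  ring_nf

theorem le_noiseStd (hL : 0 < L) (hn : 1 ≤ n) (hε : 0 < ε) (hε1 : ε ≤ 1) (hδ : 0 < δ)
    (hδ1 : δ < 1) : L ≤ noiseStd n L ε δ := by
  have h1 := one_le_log_three_mul_div hn hδ hδ1
  have h2 := half_le_log_two_div hδ hδ1
  rw [noiseStd, le_div_iff₀ hε]
  have h3 : 1 / 2 ≤ Real.sqrt (Real.log (3 * n / δ) * Real.log (2 / δ)) :=
    Real.le_sqrt_of_sq_le (by nlinarith)
  nlinarith

/-- The dimension-dependent part of `σ` dominates, up to a factor `2`. -/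
theorem noiseScale_bounds (hL : 0 < L) (hd : 1 ≤ d) (hn : 1 ≤ n) (hε : 0 < ε) (hε1 : ε ≤ 1)
    (hδ : 0 < δ) (hδ1 : δ < 1) :
    Real.sqrt d * noiseStd n L ε δ ≤ noiseScale d n L ε δ ∧ 2 * L ≤ noiseScale d n L ε δ ∧
      noiseScale d n L ε δ ≤ 2 * (Real.sqrt d * noiseStd n L ε δ) := by
  have h1 := one_le_log_three_mul_div hn hδ hδ1
  have h2 := half_le_log_two_div hδ hδ1
  have hd1 : (1 : ℝ) ≤ d := by exact_mod_cast hd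
  have hρ := le_noiseStd hL hn hε hε1 hδ hδ1
  have hρ0 : 0 < noiseStd n L ε δ := hL.trans_le hρ
  have hσ : noiseScale d n L ε δ = Real.sqrt (4 * L ^ 2 + d * noiseStd n L ε δ ^ 2) := by
    rw [noiseScale, sq_noiseStd hn hδ hδ1]
    ring_nf
  have hsq : (Real.sqrt d * noiseStd n L ε δ) ^ 2 = d * noiseStd n L ε δ ^ 2 := by
    rw [mul_pow, Real.sq_sqrt (by positivity)]
  have hL2 : 2 * L ^ 2 ≤ noiseStd n L ε δ ^ 2 := by
    rw [sq_noiseStd hn hδ hδ1, le_div_iff₀ (by positivity)]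
    have h3 : 1 / 2 ≤ Real.log (3 * n / δ) * Real.log (2 / δ) := by nlinarith
    have h4 : ε ^ 2 ≤ 1 := by nlinarith
    have h5 : 0 < L ^ 2 := by positivity
    nlinarith
  have hdL : 2 * L ^ 2 ≤ d * noiseStd n L ε δ ^ 2 := by nlinarith
  rw [hσ]
  refine ⟨Real.le_sqrt_of_sq_le (by rw [hsq]; nlinarith), Real.le_sqrt_of_sq_le (by nlinarith),
    Real.sqrt_le_iff.2 ⟨by positivity, ?_⟩⟩
  rw [mul_pow, hsq]
  linarith [sq_nonneg L]

/-- The numerical constants inside the logarithms are absorbed because `δ ≤ κ < 1` bounds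
`log (n / δ)` and `log (1 / δ)` away from zero. -/
theorem noiseStd_le {κ : ℝ} (hL : 0 < L) (hn : 1 ≤ n) (hε : 0 < ε) (hδ : 0 < δ) (hδκ : δ ≤ κ)
    (hκ : κ < 1) :
    noiseStd n L ε δ ≤ 2 * L * (1 + 2 / Real.log (1 / κ)) *
      Real.sqrt (Real.log (n / δ) * Real.log (1 / δ)) / ε := by
  have hκ0 : 0 < κ := hδ.trans_le hδκ
  have hn0 : (1 : ℝ) ≤ n := by exact_mod_cast hn
  have hl : 0 < Real.log (1 / κ) := Real.log_pos (by rw [lt_div_iff₀ hκ0]; linarith)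
  have hl1 : Real.log (1 / κ) ≤ Real.log (1 / δ) :=
    Real.log_le_log (by positivity) (by gcongr)
  have hl2 : Real.log (1 / δ) ≤ Real.log (n / δ) :=
    Real.log_le_log (by positivity) (by gcongr)
  have hlog3 : Real.log 3 ≤ 2 := by
    have := Real.log_le_sub_one_of_pos (show (0 : ℝ) < 3 by norm_num)
    linarith
  have hlog2 : Real.log 2 ≤ 2 := by linarith [Real.log_two_lt_d9]
  have absorb : ∀ x y : ℝ, y ≤ 2 → Real.log (1 / κ) ≤ x → y + x ≤ (1 + 2 / Real.log (1 / κ)) * x :=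
    fun x y hy hx => by
      have : 2 ≤ 2 / Real.log (1 / κ) * x := by
        rw [div_mul_eq_mul_div, le_div_iff₀ hl]
        linarith
      linarith
  have h1 : Real.log (3 * n / δ) ≤ (1 + 2 / Real.log (1 / κ)) * Real.log (n / δ) := by
    rw [mul_div_assoc, Real.log_mul (by norm_num) (by positivity)]
    exact absorb _ _ hlog3 (hl1.trans hl2)
  have h2 : Real.log (2 / δ) ≤ (1 + 2 / Real.log (1 / κ)) * Real.log (1 / δ) := by
    rw [div_eq_mul_one_div, Real.log_mul (by norm_num) (by positivity)]
    exact absorb _ _ hlog2 hl1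
  have h3 : 0 ≤ Real.log (3 * n / δ) := by
    linarith [one_le_log_three_mul_div hn hδ (hδκ.trans_lt hκ)]
  have h4 : 0 ≤ Real.log (2 / δ) := by
    linarith [half_le_log_two_div hδ (hδκ.trans_lt hκ)]
  have h5 : 0 ≤ Real.log (n / δ) := by linarith
  have hA : 0 ≤ 1 + 2 / Real.log (1 / κ) := by positivity
  have hs : Real.sqrt (Real.log (3 * n / δ) * Real.log (2 / δ)) ≤
      (1 + 2 / Real.log (1 / κ)) * Real.sqrt (Real.log (n / δ) * Real.log (1 / δ)) := by
    rw [← Real.sqrt_sq hA, ← Real.sqrt_mul (sq_nonneg _)]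
    apply Real.sqrt_le_sqrt
    calc _ ≤ (1 + 2 / Real.log (1 / κ)) * Real.log (n / δ) *
          ((1 + 2 / Real.log (1 / κ)) * Real.log (1 / δ)) := by gcongr
      _ = _ := by ring
  rw [noiseStd, mul_assoc (2 * L)]
  gcongr

end Parameters

/-! ### The output of the algorithm -/

section Output

variable {d n : ℕ} {X : Type*} {f : EuclideanSpace ℝ (Fin d) → X → ℝ} {S : Fin n → X}

/-- For a constant nonzero step size the number of rounds is uniformly distributed. -/
theorem expectedSqGrad_const {T : ℕ} {β h : ℝ} (hT : 0 < T) (hh : 0 < h) (hβh : β * h ≤ 1)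
    {P : PMF (Fin T)} (hP : IsRoundLaw β (fun _ => h) P) (w₀ : EuclideanSpace ℝ (Fin d))
    (ω : Fin T → Fin n × EuclideanSpace ℝ (Fin d)) :
    expectedSqGrad f S (fun _ => h) w₀ P ω = 1 / (T : ℝ) *
      ∑ t : Fin T, ‖gradient (empiricalRisk f S)
        (noisyIterate f S (fun _ => h) w₀ ω t.succ)‖ ^ 2 := by
  have hT0 : (0 : ℝ) < T := by exact_mod_cast hT
  have hc : 0 < 2 * h - β * h ^ 2 := by nlinarith
  rw [expectedSqGrad, mul_sum]
  refine sum_congr rfl fun k _ => ?_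
  have h1 := hP k
  simp only [sum_const, card_univ, Fintype.card_fin, nsmul_eq_mul] at h1
  have h2 : (P k).toReal = 1 / (T : ℝ) := by
    rw [eq_div_iff hT0.ne']
    apply mul_right_cancel₀ hc.ne'
    linarith
  rw [h2]

theorem expectedSqGrad_le {T : ℕ} {η : Fin T → ℝ} {w₀ : EuclideanSpace ℝ (Fin d)}
    {ω : Fin T → Fin n × EuclideanSpace ℝ (Fin d)} {c : ℝ} (P : PMF (Fin T))
    (hc : ∀ k : Fin T, ‖gradient (empiricalRisk f S) (noisyIterate f S η w₀ ω k.succ)‖ ^ 2 ≤ c) :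
    expectedSqGrad f S η w₀ P ω ≤ c := by
  have hP : ∑ k, (P k).toReal = 1 := by
    rw [← ENNReal.toReal_sum fun k _ => P.apply_ne_top k, ← tsum_fintype (L := .unconditional _),
      P.tsum_coe, ENNReal.toReal_one]
  calc _ ≤ ∑ k, (P k).toReal * c :=
        sum_le_sum fun k _ => mul_le_mul_of_nonneg_left (hc k) ENNReal.toReal_nonneg
    _ = c := by rw [← sum_mul, hP, one_mul]

theorem noisyIterate_zero_step {T : ℕ} (w₀ : EuclideanSpace ℝ (Fin d))
    (ω : Fin T → Fin n × EuclideanSpace ℝ (Fin d)) (k : Fin (T + 1)) :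
    noisyIterate f S (fun _ => 0) w₀ ω k = w₀ := by
  induction k using Fin.induction with
  | zero => rfl
  | succ k ih => rw [noisyIterate_succ, ih, zero_smul, sub_zero]

theorem gradient_eq_zero_of_initialGap_eq_zero {β : ℝ} (hβ : 0 < β)
    (hbdd : BddBelow (Set.range (empiricalRisk f S))) {w₀ : EuclideanSpace ℝ (Fin d)}
    (h0 : initialGap β f S w₀ = 0) : gradient (empiricalRisk f S) w₀ = 0 := by
  have hle : empiricalRisk f S w₀ ≤ ⨅ w, empiricalRisk f S w := by
    have := Real.sqrt_eq_zero'.1 h0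
    rw [div_le_iff₀ hβ] at this
    linarith
  have hmin : IsLocalMin (empiricalRisk f S) w₀ :=
    Filter.Eventually.of_forall fun w => hle.trans (ciInf_le hbdd w)
  rw [gradient, hmin.fderiv_eq_zero, map_zero]

theorem mul_sq_initialGap {β : ℝ} (hβ : 0 < β)
    (hbdd : BddBelow (Set.range (empiricalRisk f S))) (w₀ : EuclideanSpace ℝ (Fin d)) :
    β * initialGap β f S w₀ ^ 2 = 2 * (empiricalRisk f S w₀ - ⨅ w, empiricalRisk f S w) := by
  have : 0 ≤ empiricalRisk f S w₀ - ⨅ w, empiricalRisk f S w := sub_nonneg.2 (ciInf_le hbdd w₀)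
  rw [initialGap, Real.sq_sqrt (by positivity)]
  field_simp

/-- The bound in terms of the standard deviation `ρ` of the noise. If `log (1 / γ) > n²`, it
follows from `‖∇F‖ ≤ L`; otherwise it is the Chernoff bound for the stochastic terms. -/
theorem expectedSqGrad_tail {L β D l ε δ γ : ℝ} (hL : 0 < L) (hβ : 0 < β) (hl : 0 < l)
    (hd : 1 ≤ d) (hn : 1 ≤ n)
    (hLip : ∀ i, LipschitzWith L.toNNReal fun w => f w (S i))
    (hf : ∀ i, IsBetaSmooth β fun w => f w (S i))
    (hbdd : BddBelow (Set.range (empiricalRisk f S)))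
    (w₀ : EuclideanSpace ℝ (Fin d)) (hG : 0 < initialGap β f S w₀) (hGD : initialGap β f S w₀ ≤ D)
    (hε : 0 < ε) (hε1 : ε ≤ 1) (hδ : 0 < δ) (hδ1 : δ < 1) (hγ : 0 < γ)
    (hlγ : l ≤ Real.sqrt (Real.log (1 / γ)))
    (P : PMF (Fin (n ^ 2))) (hP : IsRoundLaw β (tunedStep L β ε δ f S w₀) P) :
    1 - γ ≤ (drawsLaw d n L ε δ).real
      {ω | expectedSqGrad f S (tunedStep L β ε δ f S w₀) w₀ P ω ≤
        (β ^ 2 * D ^ 2 / (l * L) + 14 * β * D / l + 6 * L ^ 2 + 2 * (4 * β * D + 1) + L / l + L) *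
          (Real.sqrt d * Real.sqrt (Real.log (1 / γ)) * noiseStd n L ε δ / n)} := by
  have hD : 0 < D := hG.trans_le hGD
  have hn0 : (1 : ℝ) ≤ n := by exact_mod_cast hn
  have hq : 1 ≤ Real.sqrt d := Real.one_le_sqrt.2 (by exact_mod_cast hd)
  have hρ := le_noiseStd hL hn hε hε1 hδ hδ1
  have hbeq := noiseRate_eq (L := L) (ε := ε) hn hδ hδ1
  obtain ⟨hσ1, hσ2, hσ3⟩ := noiseScale_bounds hL hd hn hε hε1 hδ hδ1
  set G := initialGap β f S w₀ with hGdef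
  set ρ := noiseStd n L ε δ
  set σ := noiseScale d n L ε δ with hσdef
  set Λ := Real.sqrt (Real.log (1 / γ)) with hΛdef
  set h := min (1 / β) (G / (σ * n)) with hh
  have hstep : tunedStep L β ε δ f S w₀ = fun _ => h := rfl
  rw [hstep] at hP ⊢
  have hρ0 : 0 < ρ := hL.trans_le hρ
  have hσ0 : 0 < σ := by linarith
  have hΛ0 : 0 < Λ := hl.trans_le hlγ
  have hb : 0 < noiseRate n L ε δ := by rw [hbeq]; positivity
  have hh0 : 0 < h := lt_min (by positivity) (by positivity)
  have hβh : β * h ≤ 1 := by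
    calc β * h ≤ β * (1 / β) := by gcongr; exact min_le_left _ _
      _ = 1 := by field_simp
  have hdiff := fun i => (hf i).1
  have hU0 : 0 ≤ Real.sqrt d * Λ * ρ / n := by positivity
  have hC0 : 0 ≤ β ^ 2 * D ^ 2 / (l * L) + 14 * β * D / l + 6 * L ^ 2 + 2 * (4 * β * D + 1)
      + L / l := by positivity
  have := isProbabilityMeasure_uniformOn_fin hn
  have := isProbabilityMeasure_noiseLaw (d := d) hb
  have : IsProbabilityMeasure (drawsLaw d n L ε δ) := by unfold drawsLaw; infer_instance
  rcases le_total Λ n with hΛn | hnΛ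
  · set r := Λ / (n * (4 * β * D + 1) * ρ) with hr
    have hr0 : 0 < r := by positivity
    have hrb : r * (β * h) ≤ noiseRate n L ε δ / 2 := by
      rw [hbeq]
      exact chernoff_parameter_le hβ hG hGD hn0 hρ0
        (le_trans (le_mul_of_one_le_left hρ0.le hq) hσ1) hΛ0 hΛn (min_le_right _ _)
    have htail := sum_stochasticDrift_tail hn hb hr0 hγ
      (stochasticDrift_lintegral_le hL.le hn hb (by positivity) hβh hr0.le hrb hdiff hLip) w₀
    refine htail.trans (measureReal_mono fun ω hω => ?_)
    rw [Set.mem_ofPred_eq] at hω ⊢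
    have hΛsq : Real.log (1 / γ) = Λ ^ 2 := by
      rw [hΛdef, Real.sq_sqrt (Real.sqrt_pos.1 hΛ0).le]
    have hdsq : (d : ℝ) = Real.sqrt d ^ 2 := (Real.sq_sqrt (by positivity)).symm
    rw [hbeq, hΛsq, hdsq] at hω
    have hfinal := averaged_bound_le hL hβ hG hGD hn0 hq hρ hσ1 hσ2 hσ3 hl hlγ hh
    have hdesc := sum_sq_norm_gradient_le hL.le hβ hn hh0 hβh hLip hf hbdd w₀ ω
    rw [← mul_sq_initialGap hβ hbdd, ← hGdef] at hdesc
    rw [expectedSqGrad_const (by positivity) hh0 hβh hP]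
    push_cast at hω hdesc ⊢
    refine le_trans (mul_le_mul_of_nonneg_left (hdesc.trans ?_) (by positivity))
      (hfinal.trans (mul_le_mul_of_nonneg_right (by linarith) hU0))
    gcongr
  · have huniv : {ω | expectedSqGrad f S (fun _ => h) w₀ P ω ≤
        (β ^ 2 * D ^ 2 / (l * L) + 14 * β * D / l + 6 * L ^ 2 + 2 * (4 * β * D + 1) + L / l + L) *
          (Real.sqrt d * Λ * ρ / n)} = Set.univ := by
      refine Set.eq_univ_of_forall fun ω => (expectedSqGrad_le P fun k => ?_ : _ ≤ _)
      have h1 : ‖gradient (empiricalRisk f S) (noisyIterate f S (fun _ => h) w₀ ω k.succ)‖ ^ 2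
          ≤ L ^ 2 :=
        pow_le_pow_left₀ (norm_nonneg _) (norm_gradient_empiricalRisk_le hL.le hn hdiff hLip _) 2
      have h2 : L ≤ Real.sqrt d * Λ * ρ / n := by
        rw [le_div_iff₀ (by positivity)]
        calc L * n ≤ ρ * Λ := by gcongr
          _ ≤ Real.sqrt d * (ρ * Λ) := le_mul_of_one_le_left (by positivity) hq
          _ = _ := by ring
      nlinarith [mul_nonneg hC0 hU0]
    rw [huniv, probReal_univ]
    linarith

end Output

theorem mainTheorem6 (L β D κ : ℝ) (hL : 0 < L) (hβ : 0 < β) (hκ : κ < 1) :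
    ∃ C : ℝ, 0 < C ∧
      ∀ (d n : ℕ) (_ : 1 ≤ n) (X : Type*) (S : Fin n → X)
        (f : EuclideanSpace ℝ (Fin d) → X → ℝ)
        (_ : ∀ i, LipschitzWith L.toNNReal fun w => f w (S i))
        (_ : ∀ i, IsBetaSmooth β fun w => f w (S i))
        (_ : BddBelow (Set.range (empiricalRisk f S)))
        (w₀ : EuclideanSpace ℝ (Fin d)) (_ : initialGap β f S w₀ ≤ D)
        (ε δ γ : ℝ) (_ : 0 < ε) (_ : ε ≤ 1) (_ : 0 < δ) (_ : δ ≤ κ) (_ : 0 < γ) (_ : γ ≤ κ)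
        (P : PMF (Fin (n ^ 2))) (_ : IsRoundLaw β (tunedStep L β ε δ f S w₀) P),
        1 - γ ≤ (drawsLaw d n L ε δ).real
          {ω | expectedSqGrad f S (tunedStep L β ε δ f S w₀) w₀ P ω ≤
            C * (Real.sqrt (d * Real.log (1 / γ) * Real.log (n / δ) * Real.log (1 / δ)) /
              (n * ε))} := by
  by_cases hκ0 : κ ≤ 0
  · exact ⟨1, one_pos, fun d n _ X S f _ _ _ w₀ _ ε δ γ _ _ hδ hδκ => by linarith⟩
  by_cases hD : D < 0
  · exact ⟨1, one_pos, fun d n _ X S f _ _ _ w₀ hGD =>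
      absurd ((Real.sqrt_nonneg _).trans hGD) (not_le.2 hD)⟩
  push Not at hκ0 hD
  have hlog : 0 < Real.log (1 / κ) := Real.log_pos (by rw [lt_div_iff₀ hκ0]; linarith)
  set l := Real.sqrt (Real.log (1 / κ)) with hl
  have hl0 : 0 < l := Real.sqrt_pos.2 hlog
  set C₁ := β ^ 2 * D ^ 2 / (l * L) + 14 * β * D / l + 6 * L ^ 2 + 2 * (4 * β * D + 1) + L / l + L
    with hC₁
  have hC₁0 : 0 < C₁ := by positivity
  set A := 2 * L * (1 + 2 / Real.log (1 / κ)) with hA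
  have hA0 : 0 < A := by positivity
  refine ⟨C₁ * A, by positivity, ?_⟩
  intro d n hn X S f hLip hf hbdd w₀ hGD ε δ γ hε hε1 hδ hδκ hγ hγκ P hP
  have hn0 : (1 : ℝ) ≤ n := by exact_mod_cast hn
  have hδ1 : δ < 1 := hδκ.trans_lt hκ
  have hlγ : l ≤ Real.sqrt (Real.log (1 / γ)) :=
    Real.sqrt_le_sqrt (Real.log_le_log (by positivity) (by gcongr))
  have hlogγ : 0 ≤ Real.log (1 / γ) := (Real.sqrt_pos.1 (hl0.trans_le hlγ)).le
  set Q := Real.sqrt (d * Real.log (1 / γ) * Real.log (n / δ) * Real.log (1 / δ)) / (n * ε)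
    with hQ
  have hQ0 : 0 ≤ Q := by positivity
  have hρ := le_noiseStd hL hn hε hε1 hδ hδ1
  have hb : 0 < noiseRate n L ε δ := by
    rw [noiseRate_eq hn hδ hδ1]
    have : 0 < noiseStd n L ε δ := hL.trans_le hρ
    positivity
  have := isProbabilityMeasure_uniformOn_fin hn
  have := isProbabilityMeasure_noiseLaw (d := d) hb
  have : IsProbabilityMeasure (drawsLaw d n L ε δ) := by unfold drawsLaw; infer_instance
  -- if all gradients along the iterates vanish, the event has probability one
  have trivial_case : (∀ ω k, gradient (empiricalRisk f S)
      (noisyIterate f S (tunedStep L β ε δ f S w₀) w₀ ω k) = 0) →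
      1 - γ ≤ (drawsLaw d n L ε δ).real
        {ω | expectedSqGrad f S (tunedStep L β ε δ f S w₀) w₀ P ω ≤ C₁ * A * Q} := fun h0 => by
    have huniv : {ω | expectedSqGrad f S (tunedStep L β ε δ f S w₀) w₀ P ω ≤ C₁ * A * Q}
        = Set.univ := by
      refine Set.eq_univ_of_forall fun ω => (expectedSqGrad_le P fun k => ?_ : _ ≤ _)
      rw [h0, norm_zero, zero_pow two_ne_zero]
      positivity
    rw [huniv, probReal_univ]
    linarith
  rcases Nat.eq_zero_or_pos d with rfl | hd
  · exact trivial_case fun _ _ => Subsingleton.elim _ _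
  have hG0 : 0 ≤ initialGap β f S w₀ := Real.sqrt_nonneg _
  rcases hG0.eq_or_lt with hG | hG
  · have hstep : tunedStep L β ε δ f S w₀ = fun _ => 0 := by
      funext t
      rw [tunedStep, ← hG, zero_div]
      exact min_eq_right (by positivity)
    refine trivial_case fun ω k => ?_
    rw [hstep, noisyIterate_zero_step]
    exact gradient_eq_zero_of_initialGap_eq_zero hβ hbdd hG.symm
  refine (expectedSqGrad_tail hL hβ hl0 hd hn hLip hf hbdd w₀ hG hGD hε hε1 hδ hδ1 hγ hlγ P
    hP).trans (measureReal_mono fun ω hω => ?_)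
  rw [Set.mem_ofPred_eq] at hω ⊢
  refine hω.trans ?_
  rw [mul_assoc C₁]
  gcongr
  have hQeq : A * Q = Real.sqrt d * Real.sqrt (Real.log (1 / γ)) *
      (A * Real.sqrt (Real.log (n / δ) * Real.log (1 / δ)) / ε) / n := by
    rw [hQ, mul_assoc _ (Real.log (n / δ)), Real.sqrt_mul (by positivity),
      Real.sqrt_mul (by positivity)]
    field_simp
  rw [hQeq]
  gcongr
  exact noiseStd_le hL hn hε hδ hδκ hκ
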